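/- Consider the following game (the max-distance network creation game). There are $n\ge 1$ agents, forming a finite set $V$, and a real number $\alpha>0$, the price of a link. A strategy of an agent $v$ is a subset $s_v\subseteq V\setminus\{v\}$. A strategy profile $s=(s_v)_{v\in V}$ creates the undirected graph $G_s$ on $V$ in which distinct $u,v$ are adjacent if and only if $u\in s_v$ or $v\in s_u$. The cost of agent $v$ is $$c_s(v)=\alpha\,|s_v|+\max_{u\in V} d_{G_s}(v,u),$$ where $d_{G_s}(v,u)$ is the length of a shortest path from $v$ to $u$ in $G_s$, and is $+\infty$ if there is no such path. The profile $s$ is a (pure) Nash equilibrium if $c_s(v)\le c_{s'}(v)$ for every agent $v$ and every profile $s'$ that differs from $s$ at most in the strategy of $v$. A graph $G$ on $V$ is an equilibrium graph if $G=G_s$ for some Nash equilibrium $s$. Theorem. If $\alpha>19$, then every equilibrium graph is a tree. -/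

import Mathlib

namespace MaxNCG

/-- A (pure) strategy of agent `v`: a set of agents, other than `v` itself, to which `v` builds
(and pays for) links. -/
abbrev Strategy (V : Type*) (v : V) : Type _ := {t : Finset V // v ∉ t}

/-- A strategy profile: one strategy for every agent. -/
abbrev Profile (V : Type*) : Type _ := (v : V) → Strategy V v

variable {V : Type*}

/-- The undirected graph created by a profile: `u` and `v` are adjacent when at least one of them
builds a link to the other. -/
def graph (s : Profile V) : SimpleGraph V where
  Adj u v := u ∈ (s v).1 ∨ v ∈ (s u).1
  symm := ⟨fun _ _ h => h.symm⟩
  loopless := ⟨fun v h => h.elim (s v).2 (s v).2⟩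

/-- The cost of agent `v`: `α` times the number of links it builds, plus the largest distance from
`v` to any agent, which is `⊤` when some agent is not reachable from `v`. -/
noncomputable def cost (α : ℝ) (s : Profile V) (v : V) : EReal :=
  ((α * ((s v).1.card : ℝ) : ℝ) : EReal) + (((graph s).eccent v : ENNReal) : EReal)

/-- A pure Nash equilibrium: no agent `v` can lower its own cost by passing to another profile `s'`
that differs from `s` only in the strategy of `v`. -/
def IsNashEquilibrium (α : ℝ) (s : Profile V) : Prop :=
  ∀ (v : V) (s' : Profile V), (∀ u, u ≠ v → s' u = s u) → cost α s v ≤ cost α s' v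

/-- An equilibrium graph is the graph created by some Nash equilibrium. -/
def IsEquilibriumGraph (α : ℝ) (G : SimpleGraph V) : Prop :=
  ∃ s : Profile V, IsNashEquilibrium α s ∧ graph s = G

end MaxNCG

namespace MaxNCG
open SimpleGraph
open scoped Classical

variable {V : Type*}

/-! Take a breadth-first search tree rooted at a vertex of least eccentricity, and suppose that some
link is a cross link, that is, lies outside the tree. A link to the root brings an agent within one
plus the level of every vertex whose tree path survives. Hence no agent other than the root owns two
links that it could lose at the cost of a short detour: it would trade both for a link to the root,
saving `α > 19` (`false_of_two_drops`). So the owner of a cross link owns only one, the links on the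
ten-vertex tree path going up from it are all bought downwards, and the paths of different owners
are disjoint (`eq_of_iterate_eq_iterate`). Counting non-bridge edges along these disjoint paths then
yields a path with at most one branching vertex (`exists_unbranched`). On an unbranched stretch,
replacing the link to a child by a link two vertices further on would pay unless eccentricity
strictly decreases towards the root (`ecc_lt_of_unbranched`). The owner of a cross link has
eccentricity at most one above the minimum (`ecc_le`), so the top of its path would fall below the
minimum. Hence there is no cross link. -/

/-- Used to compare distances before and after a deviation: `φ` is built from the new distances, and
`G` is the old graph. -/
theorem le_add_edist {G : SimpleGraph V} {φ : V → ℕ∞}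
    (h : ∀ x y, G.Adj x y → φ y ≤ φ x + 1) (x y : V) : φ y ≤ φ x + G.edist x y := by
  have key : ∀ {x y : V} (w : G.Walk x y), φ y ≤ φ x + w.length := by
    intro x y w
    induction w with
    | nil => simp
    | @cons a b c hab w ih =>
      calc φ c ≤ φ b + w.length := ih
        _ ≤ (φ a + 1) + w.length := by gcongr; exact h _ _ hab
        _ = φ a + (Walk.cons hab w).length := by
          rw [Walk.length_cons]; push_cast; ring
  by_cases hr : G.Reachable x y
  · obtain ⟨w, hw⟩ := hr.exists_walk_length_eq_edist
    rw [← hw]; exact key w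
  · rw [edist_eq_top_of_not_reachable hr]; simp

theorem edist_le_one_of_adj {G : SimpleGraph V} {x y : V} (h : G.Adj x y) : G.edist x y ≤ 1 :=
  (edist_eq_one_iff_adj.2 h).le

/-- The profile in which `v` switches to the strategy `t`. -/
noncomputable abbrev deviate (s : Profile V) (v : V) (t : Strategy V v) : Profile V :=
  Function.update s v t

theorem deviate_adj_of_mem_of_ne {s : Profile V} {v : V} {t : Strategy V v} {x y : V}
    (hx : x ≠ v) (h : y ∈ (s x).1) : (graph (deviate s v t)).Adj x y := by
  right
  simpa [deviate, Function.update_of_ne hx] using h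

theorem deviate_adj_of_ne {s : Profile V} {v : V} {t : Strategy V v} {x y : V}
    (hx : x ≠ v) (hy : y ≠ v) (h : (graph s).Adj x y) : (graph (deviate s v t)).Adj x y := by
  rcases h with h | h
  · exact (deviate_adj_of_mem_of_ne hy h).symm
  · exact deviate_adj_of_mem_of_ne hx h

theorem deviate_adj_of_mem {s : Profile V} {v : V} {t : Strategy V v} {y : V}
    (h : y ∈ t.1) : (graph (deviate s v t)).Adj v y := by
  right
  simpa [deviate] using h

theorem coe_natCast_enat (m : ℕ) : (((m : ℕ∞) : ENNReal) : EReal) = ((m : ℝ) : EReal) := by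
  rw [ENat.toENNReal_coe, ← ENNReal.coe_natCast, EReal.coe_nnreal_eq_coe_real, NNReal.coe_natCast]

/-! ### Finiteness of costs and the equilibrium inequality -/

section Equilibrium

variable [Fintype V] {α : ℝ} {s : Profile V}

/-- Linking to everybody has finite cost, so an equilibrium cost is finite. -/
theorem IsNashEquilibrium.connected [Nonempty V] (hs : IsNashEquilibrium α s) :
    (graph s).Connected := by
  obtain ⟨v⟩ := ‹Nonempty V›
  let t : Strategy V v := ⟨Finset.univ.erase v, by simp⟩
  have h := hs v (deviate s v t) (fun u hu => Function.update_of_ne hu _ _)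
  have hecc : (graph (deviate s v t)).eccent v ≤ 1 := by
    refine iSup_le fun z => ?_
    by_cases hz : z = v
    · subst hz; simp
    · exact edist_le_one_of_adj (deviate_adj_of_mem (by simp [t, hz]))
  have htop : (graph s).eccent v ≠ ⊤ := by
    intro htop
    unfold cost at h
    rw [htop] at h
    have h1 : (graph (deviate s v t)).eccent v ≠ ⊤ := ne_top_of_le_ne_top (by simp) hecc
    lift (graph (deviate s v t)).eccent v to ℕ using h1 with m
    rw [coe_natCast_enat, ← EReal.coe_add, ENat.toENNReal_top, EReal.coe_ennreal_top,
      EReal.coe_add_top, top_le_iff] at h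
    exact EReal.coe_ne_top _ h
  have hreach : ∀ z, (graph s).Reachable v z := fun z => by
    by_contra hz
    apply htop
    rw [eq_top_iff, ← edist_eq_top_of_not_reachable hz]
    exact le_iSup (fun u => (graph s).edist v u) z
  exact { preconnected := fun a b => (hreach a).symm.trans (hreach b), nonempty := ⟨v⟩ }

/-- The eccentricity of an agent as a natural number. -/
noncomputable def ecc (s : Profile V) (v : V) : ℕ := ((graph s).eccent v).toNat

/-- By connectivity and finiteness the default value of `toNat` at `⊤` never intervenes. -/
theorem coe_ecc (hc : (graph s).Connected) (v : V) : (ecc s v : ℕ∞) = (graph s).eccent v := by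
  have := hc.nonempty
  obtain ⟨z, hz⟩ := (graph s).exists_edist_eq_eccent_of_finite v
  rw [ecc, ENat.natCast_toNat]
  rw [← hz]
  exact edist_ne_top_iff_reachable.2 (hc.preconnected v z)

theorem edist_le_ecc (hc : (graph s).Connected) (v z : V) : (graph s).edist v z ≤ ecc s v := by
  rw [coe_ecc hc]; exact edist_le_eccent

theorem dist_le_ecc (hc : (graph s).Connected) (v z : V) : (graph s).dist v z ≤ ecc s v := by
  have := edist_le_ecc hc v z
  rw [← (hc.preconnected v z).coe_dist_eq_edist] at this
  exact_mod_cast this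

theorem ecc_le_iff (hc : (graph s).Connected) {v : V} {m : ℕ} :
    ecc s v ≤ m ↔ ∀ z, (graph s).edist v z ≤ m := by
  rw [← Nat.cast_le (α := ℕ∞), coe_ecc hc]
  exact iSup_le_iff

theorem ecc_le_ecc_add_one (hc : (graph s).Connected) {x y : V} (h : (graph s).Adj x y) :
    ecc s x ≤ ecc s y + 1 := by
  rw [ecc_le_iff hc]
  intro z
  calc (graph s).edist x z ≤ (graph s).edist x y + (graph s).edist y z := SimpleGraph.edist_triangle
    _ ≤ 1 + ecc s y := add_le_add (edist_le_one_of_adj h) (edist_le_ecc hc y z)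
    _ = ((ecc s y + 1 : ℕ) : ℕ∞) := by push_cast; ring

theorem IsNashEquilibrium.le_of_deviate (hs : IsNashEquilibrium α s) (hc : (graph s).Connected)
    {v : V} (t : Strategy V v) {m : ℕ} (h : ∀ z, (graph (deviate s v t)).edist v z ≤ m) :
    α * (s v).1.card + ecc s v ≤ α * t.1.card + m := by
  have h1 := hs v (deviate s v t) (fun u hu => Function.update_of_ne hu _ _)
  have h2 : (graph (deviate s v t)).eccent v ≤ m := iSup_le h
  unfold cost at h1
  rw [← coe_ecc hc] at h1
  have h3 : (((ecc s v : ℕ∞) : ENNReal) : EReal) = ((ecc s v : ℝ) : EReal) := coe_natCast_enat _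
  have h4 : ((((graph (deviate s v t)).eccent v : ℕ∞) : ENNReal) : EReal) ≤ ((m : ℝ) : EReal) := by
    rw [← coe_natCast_enat]
    exact EReal.coe_ennreal_le_coe_ennreal_iff.2 (by exact_mod_cast h2)
  rw [h3] at h1
  have h5 := h1.trans (add_le_add_right h4 _)
  have h6 : ((deviate s v t) v) = t := Function.update_self ..
  rw [h6, ← EReal.coe_add, ← EReal.coe_add, EReal.coe_le_coe_iff] at h5
  exact h5

end Equilibrium

/-! ### Breadth-first search trees, subtrees and non-tree edges -/

/-- A breadth-first search tree of `G`, given by its root and the parent function. -/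
structure BFSTree (G : SimpleGraph V) where
  /-- The root. -/
  root : V
  /-- The parent function, fixing the root. -/
  par : V → V
  par_root : par root = root
  adj_par : ∀ x, x ≠ root → G.Adj x (par x)
  dist_par : ∀ x, x ≠ root → G.dist root x = G.dist root (par x) + 1

theorem exists_bfsTree {G : SimpleGraph V} (hc : G.Connected) (r : V) :
    ∃ T : BFSTree G, T.root = r := by
  have h : ∀ x, ∃ y, (x = r → y = r) ∧
      (x ≠ r → G.Adj x y ∧ G.dist r x = G.dist r y + 1) := by
    intro x
    by_cases hx : x = r
    · exact ⟨r, fun _ => rfl, fun h => absurd hx h⟩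
    · obtain ⟨w, hw⟩ := hc.exists_walk_length_eq_dist x r
      cases w with
      | nil => exact absurd rfl hx
      | @cons _ y _ hxy w =>
        refine ⟨y, fun h => absurd h hx, fun _ => ⟨hxy, le_antisymm ?_ ?_⟩⟩
        · have := hc.dist_triangle (u := r) (v := y) (w := x)
          rwa [dist_eq_one_iff_adj.2 hxy.symm] at this
        · rw [Walk.length_cons] at hw
          have := dist_le w
          rw [dist_comm, dist_comm (u := r) (v := x)]
          omega
  choose f hf using h
  exact ⟨⟨r, f, (hf r).1 rfl, fun x hx => ((hf x).2 hx).1, fun x hx => ((hf x).2 hx).2⟩, rfl⟩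

namespace BFSTree

variable {G : SimpleGraph V} (T : BFSTree G)

/-- The level of a vertex: its distance from the root. -/
noncomputable def lev (x : V) : ℕ := G.dist T.root x

/-- `T.Below c z`: the vertex `z` lies in the subtree of `c`. -/
def Below (c z : V) : Prop := ∃ k, T.par^[k] z = c ∧ T.lev z = T.lev c + k

/-- The edge `xy` of the graph is not an edge of the tree. -/
def Cross (x y : V) : Prop := G.Adj x y ∧ T.par x ≠ y ∧ T.par y ≠ x

/-- `c` is joined to its parent by an edge which is not a bridge. -/
def Cyclic (c : V) : Prop := ∃ a b, T.Cross a b ∧ T.Below c a ∧ ¬ T.Below c b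

variable {T}

theorem Cross.symm {x y : V} (h : T.Cross x y) : T.Cross y x := ⟨h.1.symm, h.2.2, h.2.1⟩

theorem lev_root : T.lev T.root = 0 := by simp [lev]

theorem lev_par {x : V} (hx : x ≠ T.root) : T.lev x = T.lev (T.par x) + 1 := T.dist_par x hx

theorem lev_par_eq (x : V) : T.lev (T.par x) = T.lev x - 1 := by
  by_cases hx : x = T.root
  · subst hx; rw [T.par_root, lev_root]
  · rw [lev_par hx]; rfl

theorem ne_root_of_lev_pos {x : V} (h : 0 < T.lev x) : x ≠ T.root := by
  rintro rfl; rw [lev_root] at h; exact lt_irrefl _ h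

theorem lev_iterate (k : ℕ) (x : V) : T.lev (T.par^[k] x) = T.lev x - k := by
  induction k with
  | zero => rfl
  | succ k ih => rw [Function.iterate_succ_apply', lev_par_eq, ih]; omega

theorem lev_le_of_adj (hc : G.Connected) {x y : V} (h : G.Adj x y) : T.lev y ≤ T.lev x + 1 := by
  have := hc.dist_triangle (u := T.root) (v := x) (w := y)
  rwa [dist_eq_one_iff_adj.2 h] at this

theorem below_refl (x : V) : T.Below x x := ⟨0, rfl, rfl⟩

theorem Below.lev_le {c z : V} (h : T.Below c z) : T.lev c ≤ T.lev z := by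
  obtain ⟨k, -, h⟩ := h; omega

theorem Below.trans {a b c : V} (h : T.Below a b) (h' : T.Below b c) : T.Below a c := by
  obtain ⟨k, hk, hk'⟩ := h
  obtain ⟨l, hl, hl'⟩ := h'
  exact ⟨k + l, by rw [Function.iterate_add_apply, hl, hk], by omega⟩

theorem below_par {z : V} (hz : z ≠ T.root) : T.Below (T.par z) z := ⟨1, rfl, lev_par hz⟩

theorem below_iterate {z : V} {k : ℕ} (hk : k ≤ T.lev z) : T.Below (T.par^[k] z) z :=
  ⟨k, rfl, by rw [lev_iterate]; omega⟩

theorem below_root (z : V) : T.Below T.root z := by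
  induction h : T.lev z generalizing z with
  | zero =>
    by_cases hz : z = T.root
    · subst hz; exact below_refl _
    · have := lev_par hz; omega
  | succ n ih =>
    have hz : z ≠ T.root := ne_root_of_lev_pos (by omega)
    have := lev_par hz
    exact (ih _ (by omega)).trans (below_par hz)

theorem Below.ne_root {c z : V} (h : T.Below c z) (hz : z ≠ c) : z ≠ T.root := by
  rintro rfl
  obtain ⟨k, hk, hk'⟩ := h
  have : k = 0 := by rw [lev_root] at hk'; omega
  subst this
  exact hz hk

theorem Below.par {c z : V} (h : T.Below c z) (hz : z ≠ c) : T.Below c (T.par z) := by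
  have hr := lev_par (h.ne_root hz)
  obtain ⟨k, hk, hk'⟩ := h
  cases k with
  | zero => exact absurd hk hz
  | succ k => exact ⟨k, hk, by omega⟩

theorem Below.of_par {c z : V} (h : T.Below c (T.par z)) (hz : z ≠ T.root) : T.Below c z :=
  h.trans (below_par hz)

theorem Below.eq_of_lev_le {c z : V} (h : T.Below c z) (hl : T.lev z ≤ T.lev c) : z = c := by
  obtain ⟨k, hk, hk'⟩ := h
  have : k = 0 := by omega
  subst this
  exact hk

theorem Below.eq_iterate {c z : V} (h : T.Below c z) : c = T.par^[T.lev z - T.lev c] z := by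
  obtain ⟨k, hk, hk'⟩ := h
  rw [← hk, show T.lev z - T.lev (T.par^[k] z) = k by rw [hk]; omega]

/-- An edge that leaves the subtree of `b`, which is attached by a bridge, is the edge to the
parent of `b`. -/
theorem eq_of_below_of_not_below {b x y : V} (hb : ¬ T.Cyclic b) (hx : T.Below b x)
    (hy : ¬ T.Below b y) (h : G.Adj x y) : x = b ∧ y = T.par b := by
  by_cases h1 : T.par x = y
  · have hxb : x = b := by
      by_contra hne
      exact hy (h1 ▸ hx.par hne)
    exact ⟨hxb, by rw [← hxb, h1]⟩
  · by_cases h2 : T.par y = x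
    · refine absurd ?_ hy
      refine Below.of_par (h2 ▸ hx) ?_
      rintro rfl
      rw [T.par_root] at h2
      exact h.ne h2.symm
    · exact absurd ⟨x, y, ⟨h, h1, h2⟩, hx, hy⟩ hb

theorem Cyclic.ne_root {c : V} (h : T.Cyclic c) : c ≠ T.root := by
  rintro rfl
  obtain ⟨a, b, -, -, hb⟩ := h
  exact hb (below_root b)

theorem edist_le_of_chain {G' : SimpleGraph V} {c : V} (P : V → Prop)
    (hP : ∀ y, P y → y ≠ c → G'.Adj y (T.par y) ∧ P (T.par y)) (k : ℕ) :
    ∀ z, P z → T.par^[k] z = c → G'.edist z c ≤ k := by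
  induction k with
  | zero => intro z _ h; rw [show z = c from h]; simp
  | succ k ih =>
    intro z hz h
    by_cases hzc : z = c
    · rw [hzc]; simp
    · obtain ⟨h1, h2⟩ := hP z hz hzc
      calc G'.edist z c ≤ G'.edist z (T.par z) + G'.edist (T.par z) c :=
            SimpleGraph.edist_triangle ..
        _ ≤ 1 + k := add_le_add (edist_le_one_of_adj h1) (ih _ h2 h)
        _ = ((k + 1 : ℕ) : ℕ∞) := by push_cast; ring

/-- The predicate `P` is an invariant carried up the tree path from `z` to `c`; it certifies that
the edges of this path survive in `G'`, usually the graph after a deviation. -/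
theorem Below.edist_le {G' : SimpleGraph V} {c z : V} (h : T.Below c z) (P : V → Prop)
    (hz : P z) (hP : ∀ y, P y → T.Below c y → y ≠ c → G'.Adj y (T.par y) ∧ P (T.par y)) :
    G'.edist z c ≤ (T.lev z - T.lev c : ℕ) := by
  refine edist_le_of_chain (fun y => P y ∧ T.Below c y) ?_ _ z ⟨hz, h⟩ h.eq_iterate.symm
  rintro y ⟨hy, hb⟩ hyc
  exact ⟨(hP y hy hb hyc).1, (hP y hy hb hyc).2, hb.par hyc⟩

end BFSTree

/-! ### Four deviations and the inequalities they force -/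

section Deviations

variable [Fintype V] {α : ℝ} {s : Profile V} {T : BFSTree (graph s)}

open BFSTree

theorem lev_le_ecc (hc : (graph s).Connected) (z : V) : T.lev z ≤ ecc s T.root :=
  dist_le_ecc hc _ _

/-- An agent drops some of its links and buys a link to the root instead. The subtrees of the
children which are dropped have to be reachable by a detour. -/
theorem IsNashEquilibrium.drop_le (hs : IsNashEquilibrium α s) (hc : (graph s).Connected)
    (hα : 0 ≤ α) {x : V} (hx : x ≠ T.root) {R : Finset V} (hR : R ⊆ (s x).1) {m : ℕ}
    (hm : ecc s T.root + 1 ≤ m)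
    (hdet : ∀ y ∈ R, T.par y = x → ∃ u v, T.Below y u ∧ v ∈ (s u).1 ∧
      (∀ y' ∈ R, T.par y' = x → ¬ T.Below y' v) ∧
      ecc s T.root + 3 + 2 * (T.lev u - T.lev y) ≤ m) :
    α * R.card + ecc s x ≤ α + m := by
  let t : Strategy V x := ⟨insert T.root ((s x).1 \ R), by simp [hx, (s x).2]⟩
  set G' := graph (deviate s x t) with hG'
  have hroot : G'.Adj x T.root := deviate_adj_of_mem (by simp [t])
  -- Inside the subtree of `x` one descends from `x`; outside it one goes through the root, along
  -- tree paths that avoid `x`.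
  have hclose : ∀ z, (∀ y ∈ R, T.par y = x → ¬ T.Below y z) →
      G'.edist x z ≤ (1 + T.lev z : ℕ) := by
    intro z hz
    by_cases hxz : T.Below x z
    · rw [SimpleGraph.edist_comm]
      refine (hxz.edist_le (fun w => ∀ y ∈ R, T.par y = x → ¬ T.Below y w) hz ?_).trans
        (by exact_mod_cast (by omega))
      intro w hw hxw hwx
      have hwr := hxw.ne_root hwx
      refine ⟨?_, fun y hy hyx hyw => hw y hy hyx (hyw.of_par hwr)⟩
      by_cases hpw : T.par w = x
      · rw [hpw]
        rcases T.adj_par w hwr with h | h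
        · rw [hpw] at h
          refine (deviate_adj_of_mem ?_).symm
          have : w ∉ R := fun hwR => hw w hwR hpw (below_refl w)
          simp [t, h, this]
        · rw [hpw] at h
          exact deviate_adj_of_mem_of_ne hwx h
      · exact deviate_adj_of_ne hwx hpw (T.adj_par w hwr)
    · have h1 : G'.edist z T.root ≤ (T.lev z - T.lev T.root : ℕ) := by
        refine (below_root z).edist_le (fun w => ¬ T.Below x w) hxz ?_
        intro w hw _ hwr
        have h2 : ¬ T.Below x (T.par w) := fun h => hw (h.of_par hwr)
        refine ⟨deviate_adj_of_ne ?_ ?_ (T.adj_par w hwr), h2⟩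
        · rintro rfl; exact hw (below_refl _)
        · intro h; rw [h] at h2; exact h2 (below_refl _)
      rw [lev_root, Nat.sub_zero, SimpleGraph.edist_comm] at h1
      calc G'.edist x z ≤ G'.edist x T.root + G'.edist T.root z := SimpleGraph.edist_triangle ..
        _ ≤ 1 + (T.lev z : ℕ) := add_le_add (edist_le_one_of_adj hroot) h1
        _ = _ := by push_cast; rfl
  have hall : ∀ z, G'.edist x z ≤ m := by
    intro z
    have hzr := lev_le_ecc (T := T) hc z
    by_cases hz : ∀ y ∈ R, T.par y = x → ¬ T.Below y z
    · exact (hclose z hz).trans (by exact_mod_cast (by omega))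
    · push Not at hz
      obtain ⟨y, hy, hyx, hyz⟩ := hz
      obtain ⟨u, v, hyu, huv, hv, hum⟩ := hdet y hy hyx
      have hyr : y ≠ T.root := by
        rintro rfl; rw [T.par_root] at hyx; exact hx hyx.symm
      have hlev : T.lev y = T.lev x + 1 := hyx ▸ lev_par hyr
      have hne : ∀ w, T.Below y w → w ≠ x := by
        rintro w hw rfl; have := hw.lev_le; omega
      have hchain : ∀ w, T.Below y w → G'.edist w y ≤ (T.lev w - T.lev y : ℕ) := by
        intro w hw
        refine hw.edist_le (fun _ => True) trivial fun a _ ha hay => ⟨?_, trivial⟩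
        exact deviate_adj_of_ne (hne _ ha) (hne _ (ha.par hay)) (T.adj_par a (ha.ne_root hay))
      have hvu : G'.Adj v u := (deviate_adj_of_mem_of_ne (hne u hyu) huv).symm
      have hlv : T.lev v ≤ T.lev u + 1 := lev_le_of_adj hc (Or.inr huv)
      have h1 := hyu.lev_le
      have h2 := hyz.lev_le
      have h3 := hchain z hyz
      rw [SimpleGraph.edist_comm] at h3
      -- The detour enters the cut-off subtree by the link `uv`, climbs to `y` and descends to `z`;
      -- since `lev v ≤ lev u + 1` its length is at most `lev z + 3 + 2 (lev u - lev y)`.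
      calc G'.edist x z ≤ G'.edist x v + (G'.edist v u + (G'.edist u y + G'.edist y z)) := by
            refine (SimpleGraph.edist_triangle (v := v) ..).trans (add_le_add le_rfl ?_)
            refine (SimpleGraph.edist_triangle (v := u) ..).trans (add_le_add le_rfl ?_)
            exact SimpleGraph.edist_triangle ..
        _ ≤ (1 + T.lev v : ℕ) + (1 + ((T.lev u - T.lev y : ℕ) + (T.lev z - T.lev y : ℕ))) :=
            add_le_add (hclose v hv) (add_le_add (edist_le_one_of_adj hvu)
              (add_le_add (hchain u hyu) h3))
        _ ≤ m := by exact_mod_cast (by omega)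
  have h := hs.le_of_deviate hc t hall
  have hcard : (t.1.card : ℝ) ≤ 1 + (s x).1.card - R.card := by
    have h1 : t.1.card ≤ ((s x).1 \ R).card + 1 := Finset.card_insert_le _ _
    have h2 := Finset.card_sdiff_add_card_eq_card hR
    have h3 : t.1.card + R.card ≤ 1 + (s x).1.card := by omega
    have : (t.1.card : ℝ) + R.card ≤ 1 + (s x).1.card := by exact_mod_cast h3
    linarith
  nlinarith

/-- An agent drops a link outside the tree. -/
theorem IsNashEquilibrium.le_of_erase (hs : IsNashEquilibrium α s) (hc : (graph s).Connected)
    {u v : V} (huv : v ∈ (s u).1) {m : ℕ}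
    (h : ∀ G' : SimpleGraph V, (∀ x y, (graph s).Adj x y → ¬ (x = u ∧ y = v) → ¬ (x = v ∧ y = u) →
      G'.Adj x y) → ∀ z, G'.edist u z ≤ m) : α + ecc s u ≤ m := by
  let t : Strategy V u := ⟨(s u).1.erase v, by simp [(s u).2]⟩
  have hadj : ∀ x y, y ∈ (s x).1 → ¬ (x = u ∧ y = v) → (graph (deviate s u t)).Adj x y := by
    intro x y hxy hne
    by_cases hx : x = u
    · subst hx
      exact deviate_adj_of_mem (by simp [t, hxy]; rintro rfl; exact hne ⟨rfl, rfl⟩)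
    · exact deviate_adj_of_mem_of_ne hx hxy
  have h1 := hs.le_of_deviate hc t (h _ ?_)
  · have h2 : t.1.card + 1 = (s u).1.card := Finset.card_erase_add_one huv
    rw [← h2] at h1
    push_cast at h1
    linarith
  · intro x y hxy h1 h2
    rcases hxy with h | h
    · exact (hadj y x h fun h => h2 ⟨h.2, h.1⟩).symm
    · exact hadj x y h h1

/-- A link that is not in the tree joins vertices far from the root. -/
theorem IsNashEquilibrium.le_lev (hs : IsNashEquilibrium α s) (hc : (graph s).Connected)
    (hT : ∀ v, ecc s T.root ≤ ecc s v) {u v : V} (huv : v ∈ (s u).1) (hx : T.Cross u v) :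
    α ≤ T.lev u := by
  have h := hs.le_of_erase hc huv (m := T.lev u + ecc s T.root) ?_
  · have : (ecc s T.root : ℝ) ≤ ecc s u := by exact_mod_cast hT u
    push_cast at h
    linarith
  · intro G' hG' z
    have hchain : ∀ w, G'.edist w T.root ≤ (T.lev w : ℕ) := by
      intro w
      have := (below_root (T := T) w).edist_le (G' := G') (fun _ => True) trivial ?_
      · rwa [lev_root, Nat.sub_zero] at this
      · intro y _ _ hy
        refine ⟨hG' _ _ (T.adj_par y hy) ?_ ?_, trivial⟩
        · rintro ⟨rfl, h⟩; exact hx.2.1 h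
        · rintro ⟨rfl, h⟩; exact hx.2.2 h
    have h1 := hchain z
    rw [SimpleGraph.edist_comm] at h1
    calc G'.edist u z ≤ G'.edist u T.root + G'.edist T.root z := SimpleGraph.edist_triangle ..
      _ ≤ T.lev u + T.lev z := add_le_add (hchain u) h1
      _ ≤ _ := by
        have := lev_le_ecc (T := T) hc z
        exact_mod_cast (by omega)

/-- A link that is not in the tree does not lead back to the subtree of a near ancestor. -/
theorem IsNashEquilibrium.not_below (hs : IsNashEquilibrium α s) (hc : (graph s).Connected)
    {u v : V} (huv : v ∈ (s u).1) (hx : T.Cross u v) {c : V} (hu : T.Below c u)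
    (hα : 2 * ((T.lev u : ℝ) - T.lev c) < α) : ¬ T.Below c v := by
  intro hv
  obtain ⟨j, hj⟩ := Nat.exists_eq_add_of_le hu.lev_le
  have h := hs.le_of_erase hc huv (m := ecc s u + 2 * j) ?_
  · rw [hj] at hα
    push_cast at h hα
    linarith
  · intro G' hG' z
    have hchain : ∀ w, T.Below c w → G'.edist w c ≤ (T.lev w - T.lev c : ℕ) := by
      intro w hw
      refine hw.edist_le (fun _ => True) trivial ?_
      intro y _ hcy hy
      refine ⟨hG' _ _ (T.adj_par y (hcy.ne_root hy)) ?_ ?_, trivial⟩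
      · rintro ⟨rfl, h⟩; exact hx.2.1 h
      · rintro ⟨rfl, h⟩; exact hx.2.2 h
    have huv' : G'.edist u v ≤ (2 * j + 1 : ℕ) := by
      have h1 := hchain v hv
      rw [SimpleGraph.edist_comm] at h1
      have h2 := lev_le_of_adj (T := T) hc (Or.inr huv)
      calc G'.edist u v ≤ G'.edist u c + G'.edist c v := SimpleGraph.edist_triangle ..
        _ ≤ (T.lev u - T.lev c : ℕ) + (T.lev v - T.lev c : ℕ) := add_le_add (hchain u hu) h1
        _ ≤ _ := by exact_mod_cast (by omega)
    -- The deleted link is replaced by a detour through `c` of length at most `2j + 1`. Subtracting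
    -- `2j` with truncation leaves a function that grows by at most one even across that link, so
    -- distances from `u` grow by at most `2j`.
    have hlip := le_add_edist (G := graph s) (φ := fun y => G'.edist u y - (2 * j : ℕ)) ?_ u z
    · simp only [SimpleGraph.edist_self, zero_tsub, zero_add] at hlip
      calc G'.edist u z ≤ (graph s).edist u z + (2 * j : ℕ) := tsub_le_iff_right.1 hlip
        _ ≤ ecc s u + (2 * j : ℕ) := add_le_add (edist_le_ecc hc u z) le_rfl
        _ = _ := by push_cast; rfl
    · intro x y hxy
      rw [tsub_le_iff_right]
      by_cases h1 : x = u ∧ y = v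
      · obtain ⟨rfl, rfl⟩ := h1
        refine huv'.trans ?_
        rw [SimpleGraph.edist_self, zero_tsub]
        exact_mod_cast (by omega)
      · by_cases h2 : x = v ∧ y = u
        · obtain ⟨rfl, rfl⟩ := h2
          simp
        · calc G'.edist u y ≤ G'.edist u x + G'.edist x y := SimpleGraph.edist_triangle ..
            _ ≤ ((G'.edist u x - (2 * j : ℕ)) + (2 * j : ℕ)) + 1 :=
              add_le_add le_tsub_add (edist_le_one_of_adj (hG' x y hxy h1 h2))
            _ = _ := by ring

/-- Along a stretch without branching, an agent that buys the link to its child would rather link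
to a farther vertex, unless the child is more eccentric than the agent. -/
theorem IsNashEquilibrium.ecc_lt_of_unbranched (hs : IsNashEquilibrium α s)
    (hc : (graph s).Connected) (hα : 0 ≤ α) (hT : ∀ v, ecc s T.root ≤ ecc s v) {x₀ x₁ x₂ x₃ : V}
    (h₀ : x₁ ∈ (s x₀).1) (h₁ : T.par x₁ = x₀) (h₂ : T.par x₂ = x₁) (hl : 4 ≤ T.lev x₁)
    (h₂₃ : (graph s).Adj x₂ x₃) (h₃ : x₃ ≠ x₀) (hK : T.Cyclic x₂)
    (n₁ : ∀ y, (graph s).Adj x₁ y → y = x₀ ∨ y = x₂ ∨ (T.par y = x₁ ∧ ¬ T.Cyclic y))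
    (n₂ : ∀ y, (graph s).Adj x₂ y → y = x₁ ∨ y = x₃ ∨ (T.par y = x₂ ∧ ¬ T.Cyclic y)) :
    ecc s x₀ < ecc s x₁ := by
  by_contra! hle
  have hl₀ : T.lev x₁ = T.lev x₀ + 1 := h₁ ▸ lev_par (ne_root_of_lev_pos (by omega))
  have hl₂ : T.lev x₂ = T.lev x₁ + 1 := h₂ ▸ lev_par hK.ne_root
  let t : Strategy V x₀ := ⟨insert x₃ ((s x₀).1.erase x₁), by simp [h₃.symm, (s x₀).2]⟩
  set G' := graph (deviate s x₀ t) with hG'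
  have hx₃ : G'.Adj x₀ x₃ := deviate_adj_of_mem (by simp [t])
  have hne₂ : x₂ ≠ x₀ := by rintro rfl; omega
  have hne₁ : x₁ ≠ x₀ := by rintro rfl; omega
  have hmem : ∀ x y, y ∈ (s x).1 → y ≠ x₁ → G'.Adj x y := by
    intro x y h hy
    by_cases hx : x = x₀
    · subst hx; exact deviate_adj_of_mem (by simp [t, h, hy])
    · exact deviate_adj_of_mem_of_ne hx h
  have hadj : ∀ x y, (graph s).Adj x y → x ≠ x₁ → y ≠ x₁ → G'.Adj x y := by
    intro x y h hx hy
    rcases h with h | h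
    · exact (hmem _ _ h hx).symm
    · exact hmem _ _ h hy
  have h21 : G'.Adj x₂ x₁ :=
    deviate_adj_of_ne hne₂ hne₁ (h₂ ▸ T.adj_par x₂ hK.ne_root)
  have h32 : G'.Adj x₃ x₂ := deviate_adj_of_ne h₃ hne₂ h₂₃.symm
  -- the subtrees hanging at `x₁` and `x₂`
  let H₁ : V → Prop := fun z => z = x₁ ∨ ∃ b, T.par b = x₁ ∧ ¬ T.Cyclic b ∧ T.Below b z
  let H₂ : V → Prop := fun z => z = x₂ ∨ ∃ b, T.par b = x₂ ∧ ¬ T.Cyclic b ∧ T.Below b z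
  have hpr : ∀ a b, T.par b = a → 1 ≤ T.lev a → T.Below a b := by
    rintro a b rfl hab
    refine below_par ?_
    rintro rfl
    rw [T.par_root, lev_root] at hab
    omega
  have hbelow : ∀ z, H₁ z ∨ H₂ z → T.Below x₁ z := by
    rintro z ((rfl | ⟨b, hb, -, hz⟩) | (rfl | ⟨b, hb, -, hz⟩))
    · exact below_refl _
    · exact (hpr _ _ hb (by omega)).trans hz
    · exact hpr _ _ h₂ (by omega)
    · exact (hpr _ _ h₂ (by omega)).trans ((hpr _ _ hb (by omega)).trans hz)
  -- The new route through `x₃`, `x₂`, `x₁` costs three links and then descends; level at least 4 at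
  -- `x₁` leaves a gain of one.
  have hsub : ∀ z, T.Below x₁ z → G'.edist x₀ z ≤ (ecc s x₀ - 1 : ℕ) := by
    intro z hz
    have hne : ∀ w, T.Below x₁ w → w ≠ x₀ := by
      rintro w hw rfl; have := hw.lev_le; omega
    have h1 : G'.edist z x₁ ≤ (T.lev z - T.lev x₁ : ℕ) := by
      refine hz.edist_le (fun _ => True) trivial fun a _ ha hay => ⟨?_, trivial⟩
      exact deviate_adj_of_ne (hne _ ha) (hne _ (ha.par hay)) (T.adj_par a (ha.ne_root hay))
    rw [SimpleGraph.edist_comm] at h1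
    have h2 := lev_le_ecc (T := T) hc z
    have h3 := hT x₀
    have h4 := hz.lev_le
    calc G'.edist x₀ z ≤ G'.edist x₀ x₃ + (G'.edist x₃ x₂ + (G'.edist x₂ x₁ + G'.edist x₁ z)) := by
          refine (SimpleGraph.edist_triangle (v := x₃) ..).trans (add_le_add le_rfl ?_)
          refine (SimpleGraph.edist_triangle (v := x₂) ..).trans (add_le_add le_rfl ?_)
          exact SimpleGraph.edist_triangle ..
      _ ≤ 1 + (1 + (1 + (T.lev z - T.lev x₁ : ℕ))) :=
          add_le_add (edist_le_one_of_adj hx₃) (add_le_add (edist_le_one_of_adj h32)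
            (add_le_add (edist_le_one_of_adj h21) h1))
      _ ≤ _ := by exact_mod_cast (by omega)
  -- An old path from `x₁` leaves the two hanging parts only at `x₀`, or from `x₂` to `x₃`. The new
  -- distance from `x₀` plus one is at most 1 at `x₀` and at most 2 at `x₃`, matching the values 0
  -- and 1 on the parts just left.
  let φ : V → ℕ∞ := fun z => if H₁ z then 0 else if H₂ z then 1 else G'.edist x₀ z + 1
  have hx₂ : ¬ H₁ x₂ := by
    rintro (h | ⟨b, hb, hbK, hbz⟩)
    · rw [h] at hl₂; omega
    · have : T.lev b = T.lev x₁ + 1 := hb ▸ lev_par (by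
        rintro rfl; rw [T.par_root] at hb; rw [← hb, lev_root] at hl; omega)
      exact hbK (hbz.eq_of_lev_le (by omega) ▸ hK)
  have hlip : ∀ x y, (graph s).Adj x y → φ y ≤ φ x + 1 := by
    intro x y hxy
    by_cases hy₁ : H₁ y
    · simp [φ, hy₁]
    by_cases hy₂ : H₂ y
    · simp [φ, hy₁, hy₂]
    have hφy : φ y = G'.edist x₀ y + 1 := by simp [φ, hy₁, hy₂]
    rw [hφy]
    by_cases hx₁' : H₁ x
    · have : y = x₀ := by
        rcases hx₁' with rfl | ⟨b, hb, hbK, hbz⟩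
        · rcases n₁ y hxy with h | h | h
          · exact h
          · exact absurd (Or.inl h) hy₂
          · exact absurd (Or.inr ⟨y, h.1, h.2, below_refl y⟩) hy₁
        · by_cases hby : T.Below b y
          · exact absurd (Or.inr ⟨b, hb, hbK, hby⟩) hy₁
          · exact absurd (Or.inl ((eq_of_below_of_not_below hbK hbz hby hxy).2.trans hb)) hy₁
      subst this
      simp
    by_cases hx₂' : H₂ x
    · have h : y = x₃ := by
        rcases hx₂' with rfl | ⟨b, hb, hbK, hbz⟩
        · rcases n₂ y hxy with h | h | h
          · exact absurd (Or.inl h) hy₁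
          · exact h
          · exact absurd (Or.inr ⟨y, h.1, h.2, below_refl y⟩) hy₂
        · by_cases hby : T.Below b y
          · exact absurd (Or.inr ⟨b, hb, hbK, hby⟩) hy₂
          · exact absurd (Or.inl ((eq_of_below_of_not_below hbK hbz hby hxy).2.trans hb)) hy₂
      have hφx : φ x = 1 := by simp [φ, hx₁', hx₂']
      rw [hφx, h]
      exact add_le_add (edist_le_one_of_adj hx₃) le_rfl
    · have hφx : φ x = G'.edist x₀ x + 1 := by simp [φ, hx₁', hx₂']
      rw [hφx]
      refine add_le_add ?_ le_rfl
      refine (SimpleGraph.edist_triangle (v := x) ..).trans (add_le_add le_rfl ?_)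
      exact edist_le_one_of_adj (hadj x y hxy (fun h => hx₁' (Or.inl h)) (fun h => hy₁ (Or.inl h)))
  have hpos : 1 ≤ ecc s x₀ := by
    have h2 := lev_le_ecc (T := T) hc x₁
    have h3 := hT x₀
    omega
  have hall : ∀ z, G'.edist x₀ z ≤ (ecc s x₀ - 1 : ℕ) := by
    intro z
    by_cases hz : T.Below x₁ z
    · exact hsub z hz
    · have h1 : ¬ H₁ z := fun h => hz (hbelow z (Or.inl h))
      have h2 : ¬ H₂ z := fun h => hz (hbelow z (Or.inr h))
      have h3 := le_add_edist hlip x₁ z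
      have h4 : φ x₁ = 0 := by simp [φ, H₁]
      have h5 : φ z = G'.edist x₀ z + 1 := by simp [φ, h1, h2]
      rw [h4, h5, zero_add] at h3
      -- The new distance from `x₀` is smaller by one than the old distance from `x₁`, which is at
      -- most `ecc x₁ ≤ ecc x₀`.
      have h6 : G'.edist x₀ z + 1 ≤ ((ecc s x₀ - 1 : ℕ) : ℕ∞) + 1 := by
        refine h3.trans ((edist_le_ecc hc x₁ z).trans ?_)
        exact_mod_cast (by omega)
      exact (ENat.add_le_add_iff_right (by simp)).1 h6
  have h := hs.le_of_deviate hc t hall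
  have hcard : t.1.card ≤ (s x₀).1.card := by
    have h1 : t.1.card ≤ ((s x₀).1.erase x₁).card + 1 := Finset.card_insert_le _ _
    rwa [Finset.card_erase_add_one h₀] at h1
  have hcard' : (t.1.card : ℝ) ≤ (s x₀).1.card := by exact_mod_cast hcard
  rw [Nat.cast_sub hpos] at h
  push_cast at h
  nlinarith

end Deviations

/-! ### Branching at non-bridge edges -/

namespace BFSTree

variable {G : SimpleGraph V} {T : BFSTree G}

theorem Below.exists_child {c a : V} (h : T.Below c a) (ha : a ≠ c) :
    ∃ y, T.par y = c ∧ T.Below c y ∧ T.Below y a := by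
  obtain ⟨k, hk, hk'⟩ := h
  cases k with
  | zero => exact absurd hk ha
  | succ k =>
    rw [Function.iterate_succ_apply'] at hk
    refine ⟨T.par^[k] a, hk, ?_, below_iterate (by omega)⟩
    rw [← hk]
    exact below_par (ne_root_of_lev_pos (by rw [lev_iterate]; omega))

variable [Fintype V]

/-- The edges at `x` which are not bridges, apart from the edge to the parent: the neighbours that
are joined to `x` outside the tree, and the children that hang on a non-bridge. -/
noncomputable def branches (T : BFSTree G) (x : V) : Finset V :=
  Finset.univ.filter fun y => (T.Cyclic y ∧ T.par y = x) ∨ T.Cross x y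

theorem mem_branches {x y : V} :
    y ∈ T.branches x ↔ (T.Cyclic y ∧ T.par y = x) ∨ T.Cross x y := by
  simp [branches]

theorem Cyclic.branches_nonempty {c : V} (h : T.Cyclic c) : (T.branches c).Nonempty := by
  obtain ⟨a, b, hab, ha, hb⟩ := h
  by_cases hac : a = c
  · exact ⟨b, mem_branches.2 (Or.inr (hac ▸ hab))⟩
  · obtain ⟨y, hy, hcy, hya⟩ := ha.exists_child hac
    exact ⟨y, mem_branches.2 (Or.inl ⟨⟨a, b, hab, hya, fun h => hb (hcy.trans h)⟩, hy⟩)⟩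

theorem eq_of_branches {x z : V} (h : (T.branches x).card ≤ 1) (hz : z ∈ T.branches x) (y : V)
    (hxy : G.Adj x y) : y = T.par x ∨ y = z ∨ (T.par y = x ∧ ¬ T.Cyclic y) := by
  by_cases h1 : T.par x = y
  · exact Or.inl h1.symm
  by_cases hy : y ∈ T.branches x
  · exact Or.inr (Or.inl (Finset.card_le_one.1 h y hy z hz))
  · rw [mem_branches] at hy
    push Not at hy
    by_cases h2 : T.par y = x
    · exact Or.inr (Or.inr ⟨h2, fun h => hy.1 h h2⟩)
    · exact absurd ⟨hxy, h1, h2⟩ hy.2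

/-- A topmost vertex with a branch works: were it cyclic, it would itself be a branch of its parent.
This vertex makes the later count strict. -/
theorem exists_not_cyclic_branches {a b : V} (h : T.Cross a b) :
    ∃ x, ¬ T.Cyclic x ∧ (T.branches x).Nonempty := by
  obtain ⟨x, hx, hmin⟩ := Finset.exists_min_image
    (Finset.univ.filter fun x => (T.branches x).Nonempty) T.lev
    ⟨a, by simpa using ⟨b, mem_branches.2 (Or.inr h)⟩⟩
  simp only [Finset.mem_filter, Finset.mem_univ, true_and] at hx hmin
  refine ⟨x, fun hc => ?_, hx⟩
  have h1 := hmin (T.par x) ⟨x, mem_branches.2 (Or.inl ⟨hc, rfl⟩)⟩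
  have h2 := lev_par hc.ne_root
  omega

theorem card_branches_le (x : V) : (T.branches x).card ≤
    ((Finset.univ.filter T.Cyclic).filter fun y => T.par y = x).card +
      (Finset.univ.filter (T.Cross x)).card := by
  refine le_trans (Finset.card_le_card ?_) (Finset.card_union_le _ _)
  intro y hy
  simpa [mem_branches] using hy

/-- A connected graph all of whose edges lie in the tree is a tree. -/
theorem isTree_of_forall_not_cross (hc : G.Connected) (h : ∀ a b, ¬ T.Cross a b) : G.IsTree := by
  rw [isTree_iff_connected_and_card]
  refine ⟨hc, le_antisymm ?_ hc.card_vert_le_card_edgeSet_add_one⟩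
  -- Each edge is charged to its child endpoint, so there are at most as many edges as non-root
  -- vertices.
  have hsub : G.edgeSet ⊆ (fun z => s(z, T.par z)) '' {z | z ≠ T.root} := by
    intro e
    induction e using Sym2.ind with
    | _ a b =>
      intro hab
      rw [mem_edgeSet] at hab
      by_cases h1 : T.par a = b
      · refine ⟨a, ?_, by simp [h1]⟩
        rintro rfl
        rw [T.par_root] at h1
        exact hab.ne h1
      · have h2 : T.par b = a := by
          by_contra h2
          exact h a b ⟨hab, h1, h2⟩
        refine ⟨b, ?_, by simp [h2, Sym2.eq_swap]⟩
        rintro rfl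
        rw [T.par_root] at h2
        exact hab.ne h2.symm
  have h1 : G.edgeSet.ncard ≤ {z | z ≠ T.root}.ncard :=
    (Set.ncard_le_ncard hsub (Set.toFinite _)).trans (Set.ncard_image_le (Set.toFinite _))
  have h2 : {z : V | z ≠ T.root}.ncard + 1 = Nat.card V := by
    have := Set.ncard_add_ncard_compl {T.root}
    rw [Set.ncard_singleton] at this
    rw [← this, add_comm]
    rfl
  rw [← Nat.card_coe_set_eq] at h1
  omega

end BFSTree

/-! ### Owners of cross links and their upward paths -/

open BFSTree

variable [Fintype V] {α : ℝ} {s : Profile V} {T : BFSTree (graph s)}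

/-- A Nash equilibrium for a price above `19`, with a breadth-first search tree rooted at a vertex
of least eccentricity. -/
structure IsCentral (α : ℝ) (s : Profile V) (T : BFSTree (graph s)) : Prop where
  nash : IsNashEquilibrium α s
  connected : (graph s).Connected
  lt_price : 19 < α
  ecc_root_le : ∀ v, ecc s T.root ≤ ecc s v

/-- `u` owns the link to `v`, which is not an edge of the tree. -/
def CrossLink (T : BFSTree (graph s)) (u v : V) : Prop := T.Cross u v ∧ v ∈ (s u).1

namespace IsCentral

variable (E : IsCentral α s T)
include E

/-- No agent owns two links which can both be dropped at the price of a short detour. -/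
theorem false_of_two_drops {x a b : V}
    (hx : x ≠ T.root) (hab : a ≠ b) (ha : a ∈ (s x).1) (hb : b ∈ (s x).1)
    (hdet : ∀ y ∈ ({a, b} : Finset V), T.par y = x → ∃ u v, T.Below y u ∧ v ∈ (s u).1 ∧
      (∀ y' ∈ ({a, b} : Finset V), T.par y' = x → ¬ T.Below y' v) ∧ T.lev u ≤ T.lev y + 8) :
    False := by
  have hα := E.lt_price
  -- The allowance `19 = 3 + 2 * 8` is the cost of a detour climbing at most 8 levels; the two
  -- dropped links against one bought save `α`.
  have h := E.nash.drop_le E.connected (by linarith) hx (R := {a, b}) (m := ecc s T.root + 19)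
    (by intro y; simp; rintro (rfl | rfl) <;> assumption) (by omega) ?_
  · rw [Finset.card_pair hab] at h
    have : (ecc s T.root : ℝ) ≤ ecc s x := by exact_mod_cast E.ecc_root_le x
    push_cast at h
    linarith
  · intro y hy hyx
    obtain ⟨u, v, h1, h2, h3, h4⟩ := hdet y hy hyx
    exact ⟨u, v, h1, h2, h3, by omega⟩

/-- This depth keeps the ten-vertex path above `u` away from the root, where `par` is stationary and
levels truncate. -/
theorem le_lev {u v : V} (h : CrossLink T u v) : 20 ≤ T.lev u := by
  have h1 : ((19 : ℕ) : ℝ) < T.lev u := by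
    push_cast
    exact E.lt_price.trans_le (E.nash.le_lev E.connected E.ecc_root_le h.2 h.1)
  exact_mod_cast h1

/-- Replacing the cross link by a link to the root costs nothing and cuts off no subtree. -/
theorem ecc_le {u v : V} (h : CrossLink T u v) : ecc s u ≤ ecc s T.root + 1 := by
  have hα := E.lt_price
  have hu : u ≠ T.root := ne_root_of_lev_pos (by have := E.le_lev h; omega)
  have h2 := E.nash.drop_le E.connected (by linarith) hu (R := {v}) (m := ecc s T.root + 1)
    (by simpa using h.2) le_rfl (fun y hy hyu => ?_)
  · rw [Finset.card_singleton] at h2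
    have : (ecc s u : ℝ) ≤ (ecc s T.root + 1 : ℕ) := by push_cast at h2 ⊢; linarith
    exact_mod_cast this
  · rw [Finset.mem_singleton] at hy
    subst hy
    exact absurd hyu h.1.2.2

theorem not_below_iterate {u v : V} (h : CrossLink T u v) {j : ℕ} (hj : j ≤ 9) :
    ¬ T.Below (T.par^[j] u) v := by
  have h1 := E.le_lev h
  refine E.nash.not_below E.connected h.2 h.1 (below_iterate (by omega)) ?_
  have hα := E.lt_price
  rw [lev_iterate, Nat.cast_sub (by omega)]
  have : (j : ℝ) ≤ 9 := by exact_mod_cast hj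
  linarith

theorem iterate_ne_root {u v : V} (h : CrossLink T u v) {j : ℕ} (hj : j ≤ 10) :
    T.par^[j] u ≠ T.root := by
  have := E.le_lev h
  exact ne_root_of_lev_pos (by rw [lev_iterate]; omega)

theorem adj_iterate {u v : V} (h : CrossLink T u v) {j : ℕ} (hj : j ≤ 10) :
    (graph s).Adj (T.par^[j] u) (T.par^[j + 1] u) := by
  rw [Function.iterate_succ_apply']
  exact T.adj_par _ (E.iterate_ne_root h hj)

/-- The near ancestors of the owner of a link outside the tree do not own the links to their
parents. -/
theorem not_mem_iterate {u v : V} (h : CrossLink T u v) {j : ℕ} (hj : j ≤ 9) :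
    T.par^[j + 1] u ∉ (s (T.par^[j] u)).1 := by
  have hl := E.le_lev h
  have hne : ∀ k ≤ 9, T.par (T.par^[k + 1] u) ≠ T.par^[k] u := by
    intro k hk heq
    have := congrArg T.lev heq
    rw [← Function.iterate_succ_apply' T.par, lev_iterate, lev_iterate] at this
    omega
  induction j with
  | zero =>
    intro hm
    refine E.false_of_two_drops (E.iterate_ne_root h (j := 0) (by omega)) (a := T.par^[0 + 1] u)
      (b := v) h.1.2.1 hm h.2 ?_
    intro y hy hyx
    rw [Finset.mem_insert, Finset.mem_singleton] at hy
    rcases hy with rfl | rfl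
    · exact absurd hyx (hne 0 (by omega))
    · exact absurd hyx h.1.2.2
  | succ j ih =>
    intro hm
    -- By induction this ancestor also owns the link down the path. It could then drop both: the
    -- subtree below is rejoined by `uv`, at most 8 levels further down.
    have hown : T.par^[j] u ∈ (s (T.par^[j + 1] u)).1 :=
      (E.adj_iterate h (j := j) (by omega)).resolve_right (ih (by omega))
    refine E.false_of_two_drops (E.iterate_ne_root h (j := j + 1) (by omega)) ?_ hm hown ?_
    · intro heq
      have := congrArg T.lev heq
      rw [lev_iterate, lev_iterate] at this
      omega
    · intro y hy hyx
      rw [Finset.mem_insert, Finset.mem_singleton] at hy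
      rcases hy with rfl | rfl
      · exact absurd hyx (hne (j + 1) (by omega))
      · refine ⟨u, v, below_iterate (by omega), h.2, ?_, by rw [lev_iterate]; omega⟩
        intro y' hy' hyx'
        rw [Finset.mem_insert, Finset.mem_singleton] at hy'
        rcases hy' with rfl | rfl
        · exact absurd hyx' (hne (j + 1) (by omega))
        · exact E.not_below_iterate h (by omega)

theorem mem_iterate {u v : V} (h : CrossLink T u v) {j : ℕ} (hj : j ≤ 9) :
    T.par^[j] u ∈ (s (T.par^[j + 1] u)).1 :=
  (E.adj_iterate h (by omega)).resolve_right (E.not_mem_iterate h hj)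

/-- If `u` lay strictly above `u'` on its path, it could drop both its own cross link and its link
towards `u'`, whose subtree is rejoined by the cross link of `u'`. -/
theorem eq_of_eq_iterate {u v u' v' : V} (h : CrossLink T u v) (h' : CrossLink T u' v') {j : ℕ}
    (hj : j ≤ 9) (heq : u = T.par^[j] u') : u = u' := by
  cases j with
  | zero => exact heq
  | succ j =>
    exfalso
    have hl := E.le_lev h'
    have hpar : T.par (T.par^[j] u') = u := by rw [heq, Function.iterate_succ_apply']
    refine E.false_of_two_drops (x := u) (a := v) (b := T.par^[j] u')
      (E.iterate_ne_root h (j := 0) (by omega)) ?_ h.2 (heq ▸ E.mem_iterate h' (by omega)) ?_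
    · rintro rfl
      exact h.1.2.2 hpar
    · intro y hy hyx
      rw [Finset.mem_insert, Finset.mem_singleton] at hy
      rcases hy with rfl | rfl
      · exact absurd hyx h.1.2.2
      · refine ⟨u', v', below_iterate (by omega), h'.2, ?_, by rw [lev_iterate]; omega⟩
        intro y' hy' hyx'
        rw [Finset.mem_insert, Finset.mem_singleton] at hy'
        rcases hy' with rfl | rfl
        · exact absurd hyx' h.1.2.2
        · exact E.not_below_iterate h' (by omega)

/-- The paths from two owners of links outside the tree to their near ancestors are disjoint. -/
theorem eq_of_iterate_eq_iterate {u v u' v' : V} (h : CrossLink T u v) (h' : CrossLink T u' v')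
    {i j : ℕ} (hi : i ≤ 9) (hj : j ≤ 9) (heq : T.par^[i] u = T.par^[j] u') : u = u' := by
  induction i generalizing j with
  | zero => exact E.eq_of_eq_iterate h h' hj heq
  | succ i ih =>
    cases j with
    | zero => exact (E.eq_of_eq_iterate h' h hi heq.symm).symm
    | succ j =>
      by_cases hne : T.par^[i] u = T.par^[j] u'
      · exact ih (by omega) (by omega) hne
      · exfalso
        have hl := E.le_lev h
        have hl' := E.le_lev h'
        have hbu : T.Below (T.par^[i + 1] u) (T.par^[i] u) := by
          rw [Function.iterate_succ_apply']
          exact below_par (E.iterate_ne_root h (by omega))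
        have hbu' : T.Below (T.par^[j + 1] u') (T.par^[j] u') := by
          rw [Function.iterate_succ_apply']
          exact below_par (E.iterate_ne_root h' (by omega))
        -- Where two paths first meet, the common vertex owns both links down. Each subtree is
        -- rejoined by its own cross link, which ends outside the whole subtree of the meeting
        -- vertex.
        refine E.false_of_two_drops (E.iterate_ne_root h (j := i + 1) (by omega)) hne
          (E.mem_iterate h (by omega)) (heq ▸ E.mem_iterate h' (by omega)) ?_
        have hv : ∀ y' ∈ ({T.par^[i] u, T.par^[j] u'} : Finset V),
            T.Below (T.par^[i + 1] u) y' := by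
          intro y' hy'
          rw [Finset.mem_insert, Finset.mem_singleton] at hy'
          rcases hy' with rfl | rfl
          · exact hbu
          · rw [heq]; exact hbu'
        intro y hy hyx
        rw [Finset.mem_insert, Finset.mem_singleton] at hy
        rcases hy with rfl | rfl
        · exact ⟨u, v, below_iterate (by omega), h.2, fun y' hy' _ hb =>
            E.not_below_iterate h hi ((hv y' hy').trans hb), by rw [lev_iterate]; omega⟩
        · exact ⟨u', v', below_iterate (by omega), h'.2, fun y' hy' _ hb =>
            E.not_below_iterate h' hj (heq ▸ (hv y' hy').trans hb), by rw [lev_iterate]; omega⟩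

theorem cyclic_iterate {u v : V} (h : CrossLink T u v) {j : ℕ} (hj : j ≤ 9) :
    T.Cyclic (T.par^[j] u) :=
  ⟨u, v, h.1, below_iterate (by have := E.le_lev h; omega), E.not_below_iterate h hj⟩

/-! ### Counting branches on the disjoint paths -/

/-- The number of edges outside the tree is at most the number of their owners. -/
theorem sum_card_cross_le : ∑ x, (Finset.univ.filter (T.Cross x)).card ≤
    2 * (Finset.univ.filter fun u => ∃ v, CrossLink T u v).card := by
  have hle : ∀ x, (Finset.univ.filter (T.Cross x)).card ≤
      (Finset.univ.filter fun y => CrossLink T x y).card +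
        (Finset.univ.filter fun y => CrossLink T y x).card := by
    intro x
    refine le_trans (Finset.card_le_card ?_) (Finset.card_union_le _ _)
    intro y hy
    simp only [Finset.mem_filter, Finset.mem_univ, true_and, Finset.mem_union] at hy ⊢
    rcases hy.1 with h | h
    · exact Or.inr ⟨hy.symm, h⟩
    · exact Or.inl ⟨hy, h⟩
  have hone : ∀ x, (Finset.univ.filter fun y => CrossLink T x y).card ≤
      if ∃ v, CrossLink T x v then 1 else 0 := by
    intro x
    split_ifs with hx
    · refine Finset.card_le_one.2 fun a ha b hb => ?_
      simp only [Finset.mem_filter, Finset.mem_univ, true_and] at ha hb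
      by_contra hab
      refine E.false_of_two_drops (E.iterate_ne_root ha (j := 0) (by omega)) hab ha.2 hb.2 ?_
      intro y hy hyx
      rw [Finset.mem_insert, Finset.mem_singleton] at hy
      rcases hy with rfl | rfl
      · exact absurd hyx ha.1.2.2
      · exact absurd hyx hb.1.2.2
    · push Not at hx
      simp [hx]
  have hsum : ∑ x, (Finset.univ.filter fun y => CrossLink T x y).card ≤
      (Finset.univ.filter fun u => ∃ v, CrossLink T u v).card := by
    rw [Finset.card_filter]
    exact Finset.sum_le_sum fun x _ => hone x
  have hswap : ∑ x, (Finset.univ.filter fun y => CrossLink T y x).card =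
      ∑ x, (Finset.univ.filter fun y => CrossLink T x y).card :=
    (Finset.sum_card_bipartiteAbove_eq_sum_card_bipartiteBelow (CrossLink T)).symm
  calc _ ≤ ∑ x, ((Finset.univ.filter fun y => CrossLink T x y).card +
        (Finset.univ.filter fun y => CrossLink T y x).card) := Finset.sum_le_sum fun x _ => hle x
    _ ≤ _ := by rw [Finset.sum_add_distrib, hswap]; omega

/-- Some path from the owner of a link outside the tree to its near ancestors branches at most
once. -/
theorem exists_unbranched {a b : V} (hab : T.Cross a b) : ∃ u v, CrossLink T u v ∧
    ∑ j ∈ Finset.range 10, ((T.branches (T.par^[j] u)).card - 1) ≤ 1 := by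
  by_contra! hcon
  set U := Finset.univ.filter fun u => ∃ v, CrossLink T u v with hU
  set K := Finset.univ.filter T.Cyclic with hK
  -- A cyclic vertex is counted once, at its parent; a cross edge is counted at both ends.
  have h1 : ∑ x, (T.branches x).card ≤ K.card + 2 * U.card := by
    calc _ ≤ ∑ x, ((K.filter fun y => T.par y = x).card +
          (Finset.univ.filter (T.Cross x)).card) :=
          Finset.sum_le_sum fun x _ => card_branches_le x
      _ ≤ _ := by
        rw [Finset.sum_add_distrib]
        refine add_le_add (le_of_eq ?_) E.sum_card_cross_le
        exact (Finset.card_eq_sum_card_fiberwise fun _ _ => Finset.mem_coe.2 (Finset.mem_univ _)).symm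
  have h2 : ∑ x ∈ K, (T.branches x).card + 1 ≤ ∑ x, (T.branches x).card := by
    obtain ⟨x, hx, hx'⟩ := exists_not_cyclic_branches hab
    have hxK : x ∉ K := by simpa [K] using hx
    calc _ ≤ ∑ x ∈ K, (T.branches x).card + (T.branches x).card :=
          Nat.add_le_add_left hx'.card_pos _
      _ = ∑ x ∈ insert x K, (T.branches x).card := by
          rw [Finset.sum_insert hxK, add_comm]
      _ ≤ _ := Finset.sum_le_sum_of_subset (Finset.subset_univ _)
  have h3 : ∑ x ∈ K, (T.branches x).card = ∑ x ∈ K, ((T.branches x).card - 1) + K.card := by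
    rw [Finset.card_eq_sum_ones, ← Finset.sum_add_distrib]
    refine Finset.sum_congr rfl fun x hx => ?_
    have hx' : T.Cyclic x := by simpa [K] using hx
    have := hx'.branches_nonempty.card_pos
    omega
  -- The paths are disjoint and consist of cyclic vertices, so their total excess of branches over
  -- one per vertex is at most that of all cyclic vertices, which `h1`, `h2` and `h3` keep below `2
  -- * U.card`.
  have h4 : ∑ p ∈ U ×ˢ Finset.range 10, ((T.branches (T.par^[p.2] p.1)).card - 1) ≤
      ∑ x ∈ K, ((T.branches x).card - 1) := by
    rw [← Finset.sum_image (s := U ×ˢ Finset.range 10) (g := fun p : V × ℕ => T.par^[p.2] p.1)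
      (f := fun x => (T.branches x).card - 1)]
    · refine Finset.sum_le_sum_of_subset fun x hx => ?_
      obtain ⟨⟨u, j⟩, hp, rfl⟩ := Finset.mem_image.1 hx
      simp only [U, K, Finset.mem_product, Finset.mem_filter, Finset.mem_univ, true_and,
        Finset.mem_range] at hp ⊢
      obtain ⟨⟨v, hv⟩, hj⟩ := hp
      exact E.cyclic_iterate hv (by omega)
    · rintro ⟨u, i⟩ hp ⟨u', j⟩ hq heq
      simp only [U, Finset.coe_product, Set.mem_prod, Finset.mem_coe, Finset.mem_filter,
        Finset.mem_univ, true_and, Finset.mem_range] at hp hq heq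
      obtain ⟨⟨v, hv⟩, hi⟩ := hp
      obtain ⟨⟨v', hv'⟩, hj⟩ := hq
      obtain rfl := E.eq_of_iterate_eq_iterate hv hv' (by omega) (by omega) heq
      have h5 := congrArg T.lev heq
      rw [lev_iterate, lev_iterate] at h5
      have h6 := E.le_lev hv
      rw [show i = j by omega]
  have h5 : ∑ _u ∈ U, 2 ≤ ∑ p ∈ U ×ˢ Finset.range 10, ((T.branches (T.par^[p.2] p.1)).card - 1) := by
    rw [Finset.sum_product]
    refine Finset.sum_le_sum fun u hu => ?_
    obtain ⟨v, hv⟩ : ∃ v, CrossLink T u v := by simpa [U] using hu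
    exact hcon u v hv
  rw [Finset.sum_const, smul_eq_mul] at h5
  omega

/-- The eccentricity grows on the way down an unbranched stretch. -/
theorem ecc_iterate_lt {u v : V} (h : CrossLink T u v) {i : ℕ} (hi : i ≤ 7)
    (h₂ : (T.branches (T.par^[i] u)).card ≤ 1) (h₁ : (T.branches (T.par^[i + 1] u)).card ≤ 1) :
    ecc s (T.par^[i + 2] u) < ecc s (T.par^[i + 1] u) := by
  have hα := E.lt_price
  have hl := E.le_lev h
  have n₁ := eq_of_branches h₁ (z := T.par^[i] u)
    (mem_branches.2 (Or.inl ⟨E.cyclic_iterate h (by omega),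
      (Function.iterate_succ_apply' T.par i u).symm⟩))
  rw [← Function.iterate_succ_apply' T.par] at n₁
  -- The stretch continues downwards to the previous path vertex, or across the cross link when it
  -- starts at `u` itself.
  obtain ⟨x₃, hx₃, hadj, hne⟩ : ∃ x₃, x₃ ∈ T.branches (T.par^[i] u) ∧
      (graph s).Adj (T.par^[i] u) x₃ ∧ x₃ ≠ T.par^[i + 2] u := by
    cases i with
    | zero =>
      refine ⟨v, mem_branches.2 (Or.inr h.1), h.1.1, ?_⟩
      intro hv
      exact E.not_below_iterate h (j := 2) (by omega) (hv ▸ below_refl _)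
    | succ i =>
      refine ⟨T.par^[i] u, mem_branches.2 (Or.inl ⟨E.cyclic_iterate h (by omega),
        (Function.iterate_succ_apply' T.par i u).symm⟩), (E.adj_iterate h (by omega)).symm, ?_⟩
      intro hv
      have := congrArg T.lev hv
      rw [lev_iterate, lev_iterate] at this
      omega
  have n₂ := eq_of_branches h₂ hx₃
  rw [← Function.iterate_succ_apply' T.par] at n₂
  exact E.nash.ecc_lt_of_unbranched E.connected (by linarith) E.ecc_root_le
    (E.mem_iterate h (j := i + 1) (by omega)) (Function.iterate_succ_apply' T.par _ u).symm
    (Function.iterate_succ_apply' T.par _ u).symm (by rw [lev_iterate]; omega) hadj hne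
    (E.cyclic_iterate h (by omega)) n₁ n₂

theorem not_cross (a b : V) : ¬ T.Cross a b := by
  intro hab
  obtain ⟨u, v, h, hsum⟩ := E.exists_unbranched hab
  obtain ⟨p, hp⟩ : ∃ p, ∀ j < 10, j ≠ p → (T.branches (T.par^[j] u)).card ≤ 1 := by
    by_contra! hcon
    -- The index 10 lies off the path and so excludes nothing; two branching vertices would give a
    -- total excess of at least 2.
    obtain ⟨i, hi, -, hi'⟩ := hcon 10
    obtain ⟨j, hj, hji, hj'⟩ := hcon i
    have h1 : ∑ k ∈ ({j, i} : Finset ℕ), ((T.branches (T.par^[k] u)).card - 1) ≤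
        ∑ k ∈ Finset.range 10, ((T.branches (T.par^[k] u)).card - 1) := by
      refine Finset.sum_le_sum_of_subset fun k hk => ?_
      rw [Finset.mem_insert, Finset.mem_singleton] at hk
      rw [Finset.mem_range]
      omega
    rw [Finset.sum_pair hji] at h1
    omega
  obtain ⟨g, hg⟩ : ∃ g : ℕ → ℕ, ∀ i, g i = ecc s (T.par^[i] u) := ⟨_, fun _ => rfl⟩
  have hup : ∀ i ≤ 7, i ≠ p → i + 1 ≠ p → g (i + 2) < g (i + 1) := by
    intro i hi h1 h2
    rw [hg, hg]
    exact E.ecc_iterate_lt h hi (hp i (by omega) h1) (hp (i + 1) (by omega) h2)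
  have hdown : ∀ i ≤ 8, g (i + 1) ≤ g i + 1 := by
    intro i hi
    rw [hg, hg]
    exact ecc_le_ecc_add_one E.connected (E.adj_iterate h (by omega)).symm
  have htop : ecc s T.root ≤ g 9 := hg 9 ▸ E.ecc_root_le _
  have hbot : g 0 ≤ ecc s T.root + 1 := hg 0 ▸ E.ecc_le h
  -- Of the eight steps from `g 1` to `g 9`, the index `p` spoils at most two; the other six
  -- decrease. Hence `g 9 ≤ g 0 + 1 + 2 - 6`, which is at most the least eccentricity minus 2.
  have a0 := hup 0 (by omega)
  have a1 := hup 1 (by omega)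
  have a2 := hup 2 (by omega)
  have a3 := hup 3 (by omega)
  have a4 := hup 4 (by omega)
  have a5 := hup 5 (by omega)
  have a6 := hup 6 (by omega)
  have a7 := hup 7 (by omega)
  have b0 := hdown 0 (by omega)
  have b1 := hdown 1 (by omega)
  have b2 := hdown 2 (by omega)
  have b3 := hdown 3 (by omega)
  have b4 := hdown 4 (by omega)
  have b5 := hdown 5 (by omega)
  have b6 := hdown 6 (by omega)
  have b7 := hdown 7 (by omega)
  have b8 := hdown 8 (by omega)
  simp only [Nat.reduceAdd] at a0 a1 a2 a3 a4 a5 a6 a7 b0 b1 b2 b3 b4 b5 b6 b7 b8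
  omega

end IsCentral
end MaxNCG

theorem theorem1 {V : Type*} [Finite V] [Nonempty V] (α : ℝ) (hα : 19 < α)
    (G : SimpleGraph V) (hG : MaxNCG.IsEquilibriumGraph α G) : G.IsTree := by
  have := Fintype.ofFinite V
  obtain ⟨s, hs, rfl⟩ := hG
  have hc := hs.connected
  obtain ⟨r, -, hr⟩ := Finset.exists_min_image Finset.univ (MaxNCG.ecc s) Finset.univ_nonempty
  obtain ⟨T, hT⟩ := MaxNCG.exists_bfsTree hc r
  have E : MaxNCG.IsCentral α s T := ⟨hs, hc, hα, fun v => hT ▸ hr v (Finset.mem_univ v)⟩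
  exact MaxNCG.BFSTree.isTree_of_forall_not_cross hc E.not_cross
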